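/- Let $\mathbb{F}_q$ be a finite field with $q$ elements and let $A=(a_{ij})\in\mathbb{F}_q^{m\times k}$. Consider the linear system $$(\star)\qquad a_{i1}x_1+\cdots+a_{ik}x_k=0\quad(i=1,\ldots,m)$$ in variables $x_1,\ldots,x_k\in\mathbb{F}_q^n$. Call an equation $b_1x_1+\cdots+b_kx_k=0$ with $b\in\mathbb{F}_q^k$ balanced if $b_1+\cdots+b_k=0$. Call two indices $j,j'\in\{1,\ldots,k\}$ equivalent if the $j$-th and $j'$-th columns of $A$ are nonzero scalar multiples of one another; the classes of this equivalence relation are the column equivalence classes of $A$, and $\ell$ denotes their number. Assume that: - $(\star)$ is of type (RC): every equation in $(\star)$ is balanced, and there is at most one column equivalence class of size $1$; - $(\star)$ is non-degenerate: the rows of $A$ are linearly independent, and every column of $A$ is nonzero; - $(\star)$ is irreducible: there is no linear system $(\star')$ in $x_1,\ldots,x_k$ such that each equation of $(\star)$ is a linear combination of equations of $(\star')$ and vice versa, and such that the variables can be partitioned into two or more nonempty classes so that every equation of $(\star')$ uses (with nonzero coefficient) only variables from one class. Then there exist constants $\beta,\gamma>0$ with $\gamma<q$ (independent of $n$) such that,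 for every $n\geq 0$, every subset $S\subseteq\mathbb{F}_q^n$ with $|S|\geq\beta\gamma^n$ contains a solution $(x_1,\ldots,x_k)\in S^k$ of $(\star)$ with the following two properties: 1. for every balanced equation $b_1x_1+\cdots+b_kx_k=0$ satisfied by $(x_1,\ldots,x_k)$, appending the row $(b_1,\ldots,b_k)$ to $A$ preserves the column equivalence classes (the enlarged matrix has the same column equivalence classes as $A$); 2. the affine hull of $\{x_1,\ldots,x_k\}$ has dimension at least $\min(k-\ell,\,k-2)$. -/

import Mathlib

/-!
A linear system over a field `F` is given by its coefficient matrix `A : Matrix ι κ F`; the rows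
(indexed by `ι`) are the equations and the columns (indexed by `κ`) are the variables. The variables
take values in an `F`-vector space, for instance `Fin n → F`.
-/

namespace LinSys

variable {F : Type*} [Field F] {ι ι' κ V : Type*}

section Equations

variable [Fintype κ] [AddCommGroup V] [Module F V]

/-- The tuple `x` satisfies the linear equation `∑ j, b j • x j = 0`. -/
def Satisfies (b : κ → F) (x : κ → V) : Prop := ∑ j, b j • x j = 0

/-- The tuple `x` is a solution of the linear system with coefficient matrix `A`. -/
def IsSolution (A : Matrix ι κ F) (x : κ → V) : Prop := ∀ i, Satisfies (A i) x

/-- The linear equation with coefficients `b` is balanced: its coefficients sum to zero. -/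
def BalancedEq (b : κ → F) : Prop := ∑ j, b j = 0

/-- A linear system is balanced if all its equations are. -/
def Balanced (A : Matrix ι κ F) : Prop := ∀ i, BalancedEq (A i)

end Equations

/-- Two column indices are equivalent if the corresponding columns of `A` are nonzero scalar
multiples of one another. -/
def colSetoid (A : Matrix ι κ F) : Setoid κ where
  r j j' := ∃ c : F, c ≠ 0 ∧ ∀ i, A i j = c * A i j'
  iseqv :=
    { refl := fun _ => ⟨1, one_ne_zero, fun _ => (one_mul _).symm⟩
      symm := by
        rintro j j' ⟨c, hc, h⟩
        exact ⟨c⁻¹, inv_ne_zero hc, fun i => by rw [h i, inv_mul_cancel_left₀ hc]⟩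
      trans := by
        rintro j j' j'' ⟨c, hc, h⟩ ⟨d, hd, h'⟩
        exact ⟨c * d, mul_ne_zero hc hd, fun i => by rw [h i, h' i, mul_assoc]⟩ }

/-- The set of column equivalence classes of `A`. -/
def colClasses (A : Matrix ι κ F) : Set (Set κ) := (colSetoid A).classes

/-- The number of column equivalence classes of `A`. -/
noncomputable def numColClasses (A : Matrix ι κ F) : ℕ := (colClasses A).ncard

/-- A linear system is of type (RC) if it is balanced and has at most one column equivalence class
of size `1`. -/
def TypeRC [Fintype κ] (A : Matrix ι κ F) : Prop :=
  Balanced A ∧ {C ∈ colClasses A | C.ncard = 1}.ncard ≤ 1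

/-- A linear system is non-degenerate if the rows of its coefficient matrix are linearly independent
and every variable is used (occurs with nonzero coefficient in at least one equation). -/
def NonDegenerate (A : Matrix ι κ F) : Prop :=
  LinearIndependent F (fun i => A i) ∧ ∀ j, ∃ i, A i j ≠ 0

/-- The equation `b` is a linear combination of the equations of the system `A`. -/
def IsCombination (A : Matrix ι κ F) (b : κ → F) : Prop :=
  b ∈ Submodule.span F (Set.range fun i => A i)

/-- Two linear systems in the same variables are equivalent if each equation of either one is a
linear combination of the equations of the other one. -/
def Equivalent (A : Matrix ι κ F) (A' : Matrix ι' κ F) : Prop :=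
  (∀ i, IsCombination A' (A i)) ∧ ∀ i, IsCombination A (A' i)

/-- A linear system is reducible if it is equivalent to a linear system (with any finite number of
equations) for which the variables can be partitioned into two or more (nonempty) classes in such a
way that every equation only uses variables from one class. A partition is given as an equivalence
relation. -/
def Reducible (A : Matrix ι κ F) : Prop :=
  ∃ (m' : ℕ) (A' : Matrix (Fin m') κ F) (P : Setoid κ),
    Equivalent A A' ∧ P.classes.Nontrivial ∧
      ∀ i, ∃ C ∈ P.classes, ∀ j, A' i j ≠ 0 → j ∈ C

/-- A linear system is irreducible if it is not reducible. -/
def Irreducible (A : Matrix ι κ F) : Prop := ¬ Reducible A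

/-- The linear system obtained from `A` by appending the equation `b`. -/
def appendEq (A : Matrix ι κ F) (b : κ → F) : Matrix (ι ⊕ Unit) κ F :=
  Matrix.fromRows A (Matrix.replicateRow Unit b)

/-- Appending the equation `b` to the system `A` preserves the column equivalence classes. -/
def PreservesColClasses (A : Matrix ι κ F) (b : κ → F) : Prop :=
  colClasses (appendEq A b) = colClasses A

/-- The dimension of the affine hull of the points `x j`. -/
noncomputable def affDim [AddCommGroup V] [Module F V] (x : κ → V) : ℕ :=
  Module.finrank F (affineSpan F (Set.range x)).direction

end LinSys

/-! Choose a representative `ρ j` of the class of each column `j` and scalars `s j` with column `j`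
equal to `s j` times column `ρ j`. Replacing `x j` by `w` and `x (ρ j)` by `u - s j • w`, where `u =
x (ρ j) + s j • x j`, preserves every equation `b` of ratio `b j = s j * b (ρ j)`, in particular the
rows of `A`, while an equation of another ratio survives for at most one `w`. So if all these sums
`u` have many representations within `S`, successive replacements yield a solution in `S` whose
relations all have the ratios `s` (`exists_generic_modification`). This is property 1. The relations
then lie in `ratioSubmodule`, of dimension at most `ℓ`, which bounds the affine dimension below by
`k - 1 - ℓ`; the bound rises to `k - ℓ` once some vector of the submodule is not a balanced
relation.

Popularity comes from the Ellenberg–Gijswijt method: few `a` have an unpopular sum `a + s • a`,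
since such a set contains a proportionally large subset without nontrivial solutions of `x + s y =
(1 + s) z`. Double counting shows that most `a` also have few partners `x` with `x + s • a`
unpopular. Hence at least half of `S` is rich.

If the submodule contains an unbalanced vector, or `ℓ ≤ 1`, a constant tuple at a rich point is a
suitable start. Otherwise irreducibility gives a dependence `t` among representative columns, and
pigeonhole gives rich tuples `p = p' + t y` with `y ≠ 0`. Taking `p` at the representatives and `p'
(ρ j)` elsewhere solves the system, but takes the value `y` on the equation supported on one class.
-/

namespace LinSys
open Finset

/-! ### Slice rank of diagonal tensors -/

/-- A subspace of dimension `d` of a coordinate space contains a vector with at least `d` nonzero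
coordinates. -/
theorem exists_finrank_le_card_support {F ι : Type*} [Field F] [Finite F] [Fintype ι]
    [DecidableEq F] (W : Submodule F (ι → F)) :
    ∃ w ∈ W, Module.finrank F W ≤ #{i | w i ≠ 0} := by
  obtain ⟨⟨w, hw⟩, hmax⟩ := Finite.exists_max fun w : W => #{i | (w : ι → F) i ≠ 0}
  refine ⟨w, hw, ?_⟩
  -- Otherwise some nonzero `u` in `W` vanishes on the support of `w`, and `w + u` has a larger
  -- support.
  by_contra! hlt
  let J : Finset ι := {i | w i ≠ 0}
  let r : W →ₗ[F] (J → F) := (LinearMap.funLeft F F (Subtype.val : J → ι)).comp W.subtype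
  have hker : LinearMap.ker r ≠ ⊥ := by
    apply LinearMap.ker_ne_bot_of_finrank_lt
    simpa using hlt
  obtain ⟨⟨u, huW⟩, hur, hu0⟩ := Submodule.exists_mem_ne_zero_of_ne_bot hker
  have hu : ∀ i, w i ≠ 0 → u i = 0 := fun i hi => by
    have := congrFun (LinearMap.mem_ker.mp hur) ⟨i, by simpa [J] using hi⟩
    simpa [r] using this
  obtain ⟨i₀, hi₀⟩ : ∃ i, u i ≠ 0 := by
    by_contra! h
    exact hu0 (Subtype.ext (funext h))
  have hlt' : #{i | w i ≠ 0} < #{i | (w + u) i ≠ 0} := by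
    apply Finset.card_lt_card
    refine (Finset.ssubset_iff_of_subset ?_).mpr ⟨i₀, ?_, ?_⟩
    · intro i
      simp only [mem_filter, mem_univ, true_and, Pi.add_apply]
      intro hi
      rwa [hu i hi, add_zero]
    · have : w i₀ = 0 := by
        by_contra h
        exact hi₀ (hu i₀ h)
      simpa [this] using hi₀
    · have : w i₀ = 0 := by
        by_contra h
        exact hi₀ (hu i₀ h)
      simpa using this
  exact absurd (hmax ⟨w + u, W.add_mem hw huW⟩) (not_le.mpr hlt')

theorem rank_matrix_add_le {F m n : Type*} [Field F] [Finite m] [Fintype n]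
    (A B : Matrix m n F) : (A + B).rank ≤ A.rank + B.rank := by
  rw [Matrix.rank, Matrix.rank, Matrix.rank, Matrix.mulVecLin_add]
  exact (Submodule.finrank_mono (LinearMap.range_add_le _ _)).trans
    (Submodule.finrank_add_le_finrank_add_finrank _ _)

/-- A matrix whose columns are combinations of the functions `f m`, `m ∈ M`, has rank at
most `#M`. -/
theorem rank_sum_le {F ι Δ μ : Type*} [Field F] [Fintype ι] [DecidableEq μ]
    (f : μ → ι → F) (M : Finset μ) (P : Finset Δ) (m : Δ → μ) (hm : ∀ D ∈ P, m D ∈ M)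
    (g : Δ → ι → F) :
    (Matrix.of fun x y => ∑ D ∈ P, f (m D) x * g D y).rank ≤ #M := by
  classical
  have : (Matrix.of fun x y => ∑ D ∈ P, f (m D) x * g D y) =
      (Matrix.of fun x (a : M) => f a x) *
        (Matrix.of fun (a : M) y => ∑ D ∈ P with m D = a, g D y) := by
    ext x y
    rw [Matrix.mul_apply, Matrix.of_apply, ← Finset.sum_fiberwise_of_maps_to hm, ← Finset.sum_coe_sort M]
    refine Finset.sum_congr rfl fun a _ => ?_
    rw [Matrix.of_apply, Matrix.of_apply, Finset.mul_sum]
    refine Finset.sum_congr rfl fun D hD => ?_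
    rw [(Finset.mem_filter.mp hD).2]
  rw [this]
  refine (Matrix.rank_mul_le_left _ _).trans ((Matrix.rank_le_card_width _).trans ?_)
  simp

/-- The slice rank of a diagonal tensor with nonzero diagonal is its size. -/
theorem card_le_three_mul_of_slices {F ι Δ μ : Type*} [Field F] [Finite F] [Fintype ι]
    [DecidableEq ι] [DecidableEq μ] (f : μ → ι → F) (M : Finset μ) (P : Finset Δ)
    (m₁ m₂ m₃ : Δ → μ) (c : Δ → F) (hP : ∀ D ∈ P, m₁ D ∈ M ∨ m₂ D ∈ M ∨ m₃ D ∈ M)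
    (hT : ∀ x y z, ∑ D ∈ P, c D * f (m₁ D) x * f (m₂ D) y * f (m₃ D) z =
      if x = y ∧ y = z then 1 else 0) :
    Fintype.card ι ≤ 3 * #M := by
  classical
  -- Contracting the third variable against a vector `w` in the kernel of `e` kills all slices with
  -- `m₃ D ∈ M`. The support of `w` can be taken of size at least `card ι - #M`.
  let e : (ι → F) →ₗ[F] (M → F) := LinearMap.pi fun a => ∑ z, f a z • LinearMap.proj z
  obtain ⟨w, hw, hsupp⟩ := exists_finrank_le_card_support (LinearMap.ker e)
  have hwM : ∀ a ∈ M, ∑ z, f a z * w z = 0 := fun a ha => by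
    have := congrFun (LinearMap.mem_ker.mp hw) ⟨a, ha⟩
    simpa [e] using this
  have hdim : Fintype.card ι ≤ Module.finrank F (LinearMap.ker e) + #M := by
    have h1 := LinearMap.finrank_range_add_finrank_ker e
    have h2 := Submodule.finrank_le (LinearMap.range e)
    simp only [Module.finrank_fintype_fun_eq_card, Fintype.card_coe] at h1 h2
    omega
  let P' : Finset Δ := {D ∈ P | m₃ D ∉ M}
  let γ : Δ → F := fun D => c D * ∑ z, f (m₃ D) z * w z
  -- The contracted tensor is a diagonal matrix of rank the support size of `w`. The surviving
  -- slices have `m₁ D ∈ M` or `m₂ D ∈ M`, so each of the two summands has rank at most `#M`.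
  have hdiag : Matrix.diagonal w =
      (Matrix.of fun x y => ∑ D ∈ P' with m₁ D ∈ M, f (m₁ D) x * (γ D * f (m₂ D) y)) +
      (Matrix.of fun y x => ∑ D ∈ P' with m₁ D ∉ M, f (m₂ D) y * (γ D * f (m₁ D) x)).transpose := by
    ext x y
    have h1 : Matrix.diagonal w x y = ∑ z, (if x = y ∧ y = z then 1 else 0) * w z := by
      by_cases hxy : x = y
      · subst hxy; simp
      · simp [hxy]
    have h2 : Matrix.diagonal w x y = ∑ D ∈ P, γ D * f (m₁ D) x * f (m₂ D) y := by
      rw [h1]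
      simp_rw [← hT, Finset.sum_mul]
      rw [Finset.sum_comm]
      refine Finset.sum_congr rfl fun D _ => ?_
      simp only [γ, Finset.mul_sum, Finset.sum_mul]
      refine Finset.sum_congr rfl fun z _ => ?_
      ring
    rw [h2, ← Finset.sum_filter_of_ne (p := fun D => m₃ D ∉ M), Matrix.add_apply,
      Matrix.transpose_apply, Matrix.of_apply, Matrix.of_apply,
      ← Finset.sum_filter_add_sum_filter_not P' (fun D => m₁ D ∈ M)]
    · congr 1 <;> refine Finset.sum_congr rfl fun D _ => by ring
    · intro D _ hne hM
      simp [γ, hwM _ hM] at hne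
  have hr : (Matrix.diagonal w).rank ≤ #M + #M := by
    rw [hdiag]
    refine (rank_matrix_add_le _ _).trans (add_le_add (rank_sum_le f M _ m₁ ?_ _) ?_)
    · intro D hD
      exact (Finset.mem_filter.mp hD).2
    · rw [Matrix.rank_transpose]
      refine rank_sum_le f M _ m₂ ?_ _
      intro D hD
      simp only [P', Finset.mem_filter] at hD
      have := hP D hD.1.1
      tauto
  rw [Matrix.rank_diagonal, Fintype.card_subtype] at hr
  omega

/-! ### The Ellenberg–Gijswijt bound -/

/-- The exponent vectors of the reduced monomials in `n` variables over a field with `q` elements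
whose degree is at most a third of the maximal one. -/
def lowMonomials (q n : ℕ) : Finset (Fin n → ℕ) :=
  {a ∈ Fintype.piFinset fun _ => range q | 3 * ∑ i, a i ≤ (q - 1) * n}

/-- The Ellenberg–Gijswijt bound for a set with only trivial solutions of a linear equation in three
variables. -/
theorem card_le_three_mul_lowMonomials {F : Type*} [Field F] [Fintype F] {n : ℕ} (c : Fin 3 → F)
    (I : Finset (Fin n → F))
    (hI : ∀ x ∈ I, ∀ y ∈ I, ∀ z ∈ I, c 0 • x + c 1 • y + c 2 • z = 0 ↔ x = y ∧ y = z) :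
    #I ≤ 3 * #(lowMonomials (Fintype.card F) n) := by
  classical
  set q := Fintype.card F with hq
  have hq2 : 1 < q := Fintype.one_lt_card
  -- By Fermat, `p` is the indicator of the equation in one coordinate; the product over the
  -- coordinates is its indicator on `Fin n → F`.
  let p : MvPolynomial (Fin 3) F := 1 - (∑ i, MvPolynomial.C (c i) * MvPolynomial.X i) ^ (q - 1)
  have hp : p.totalDegree ≤ q - 1 := by
    refine (MvPolynomial.totalDegree_sub _ _).trans (max_le (by simp) ?_)
    refine (MvPolynomial.totalDegree_pow _ _).trans ?_
    have : (∑ i, MvPolynomial.C (c i) * MvPolynomial.X i : MvPolynomial (Fin 3) F).totalDegree ≤ 1 := by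
      refine MvPolynomial.totalDegree_finsetSum_le fun i _ => ?_
      refine (MvPolynomial.totalDegree_mul _ _).trans ?_
      simp
    calc (q - 1) * _ ≤ (q - 1) * 1 := Nat.mul_le_mul_left _ this
      _ = q - 1 := mul_one _
  have hdeg : ∀ d ∈ p.support, d 0 + d 1 + d 2 ≤ q - 1 := by
    intro d hd
    have := (MvPolynomial.le_totalDegree hd).trans hp
    rwa [Finsupp.sum_fintype _ _ (by simp), Fin.sum_univ_three] at this
  have heval : ∀ a b e : F, 1 - (c 0 * a + c 1 * b + c 2 * e) ^ (q - 1) =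
      ∑ d ∈ p.support, p.coeff d * (a ^ d 0 * b ^ d 1 * e ^ d 2) := by
    intro a b e
    have := MvPolynomial.eval_eq' ![a, b, e] p
    simp only [Fin.prod_univ_three] at this
    rw [show MvPolynomial.eval ![a, b, e] p = 1 - (c 0 * a + c 1 * b + c 2 * e) ^ (q - 1) by
      simp [p, Fin.sum_univ_three]] at this
    simpa using this
  have hind : ∀ x ∈ I, ∀ y ∈ I, ∀ z ∈ I,
      ∏ i, (1 - (c 0 * x i + c 1 * y i + c 2 * z i) ^ (q - 1)) =
        if x = y ∧ y = z then (1 : F) else 0 := by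
    intro x hx y hy z hz
    rw [← if_congr (hI x hx y hy z hz) rfl rfl]
    split_ifs with h
    · refine Finset.prod_eq_one fun i _ => ?_
      have := congrFun h i
      simp only [Pi.add_apply, Pi.smul_apply, smul_eq_mul, Pi.zero_apply] at this
      rw [this, zero_pow (by omega), sub_zero]
    · obtain ⟨i, hi⟩ : ∃ i, c 0 * x i + c 1 * y i + c 2 * z i ≠ 0 := by
        by_contra! h'
        exact h (funext fun i => by simpa using h' i)
      exact Finset.prod_eq_zero (mem_univ i) (by rw [FiniteField.pow_card_sub_one_eq_one _ hi, sub_self])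
  -- `D` selects one monomial of `p` per coordinate. The total degree is at most `(q - 1) * n`, so
  -- one of the three variables carries at most a third of it.
  have key := card_le_three_mul_of_slices (F := F) (ι := I) (Δ := Fin n → Fin 3 →₀ ℕ)
    (fun (a : Fin n → ℕ) x => ∏ i, x.1 i ^ a i) (lowMonomials q n)
    (Fintype.piFinset fun _ => p.support) (fun D i => D i 0) (fun D i => D i 1) (fun D i => D i 2)
    (fun D => ∏ i, p.coeff (D i)) ?_ ?_
  · simpa using key
  · intro D hD
    rw [Fintype.mem_piFinset] at hD
    have h1 : ∀ i, D i 0 + D i 1 + D i 2 ≤ q - 1 := fun i => hdeg _ (hD i)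
    have h2 : ∑ i, D i 0 + ∑ i, D i 1 + ∑ i, D i 2 ≤ (q - 1) * n := by
      rw [← Finset.sum_add_distrib, ← Finset.sum_add_distrib]
      refine (Finset.sum_le_sum fun i _ => h1 i).trans ?_
      simp [mul_comm]
    simp only [lowMonomials, mem_filter, Fintype.mem_piFinset, mem_range]
    have h3 : (∀ i, D i 0 < q) ∧ (∀ i, D i 1 < q) ∧ ∀ i, D i 2 < q :=
      ⟨fun i => by have := h1 i; omega, fun i => by have := h1 i; omega,
        fun i => by have := h1 i; omega⟩
    simp only [h3.1, h3.2.1, h3.2.2, implies_true, true_and]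
    omega
  · intro x y z
    simp only [Subtype.ext_iff]
    rw [← hind _ x.2 _ y.2 _ z.2]
    simp_rw [heval]
    rw [Finset.prod_univ_sum]
    refine Finset.sum_congr rfl fun D _ => ?_
    simp only [Finset.prod_mul_distrib]
    ring

theorem one_le_card_lowMonomials {q : ℕ} (hq : 0 < q) (n : ℕ) : 1 ≤ #(lowMonomials q n) := by
  refine Finset.card_pos.mpr ⟨0, ?_⟩
  simp [lowMonomials, hq]

/-- Exponential-moment bound: for `0 < u < 1` each low monomial has weight `∏ u ^ (3 * a i) / u ^ (q
- 1)` at least `1`, and the sum of the weights over all reduced monomials factors as `g ^ n`. It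
remains to find `u` with `g < q`. -/
theorem exists_card_lowMonomials_le {q : ℕ} (hq : 1 < q) :
    ∃ g : ℝ, 1 ≤ g ∧ g < q ∧ ∀ n, (#(lowMonomials q n) : ℝ) ≤ g ^ n := by
  obtain ⟨u, hu0, hu1, hu⟩ : ∃ u : ℝ, 0 < u ∧ u < 1 ∧
      ∑ a ∈ range q, u ^ (3 * a) < q * u ^ (q - 1) := by
    let h : ℝ → ℝ := fun u => ∑ a ∈ range q, u ^ (3 * a) - q * u ^ (q - 1)
    have hd : HasDerivAt h (∑ a ∈ range q, ((3 * a : ℕ) : ℝ) - q * ((q - 1 : ℕ) : ℝ)) 1 := by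
      have := (HasDerivAt.fun_sum (u := range q) (x := (1 : ℝ))
        fun a _ => hasDerivAt_pow (3 * a) (1 : ℝ)).sub
        ((hasDerivAt_pow (q - 1) (1 : ℝ)).const_mul (q : ℝ))
      simpa [h, Pi.sub_def] using this
    -- Here `h 1 = 0` and the derivative at `1` is `3 * q * (q - 1) / 2 - q * (q - 1) > 0`, so `h`
    -- is negative just to the left of `1`.
    have hpos : 0 < ∑ a ∈ range q, ((3 * a : ℕ) : ℝ) - q * ((q - 1 : ℕ) : ℝ) := by
      have h2 : (∑ a ∈ range q, (a : ℝ)) * 2 = q * ((q - 1 : ℕ) : ℝ) := by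
        have := congrArg (Nat.cast (R := ℝ)) (Finset.sum_range_id_mul_two q)
        push_cast at this
        exact this
      have h3 : (0 : ℝ) < q * ((q - 1 : ℕ) : ℝ) := by
        have : 0 < q * (q - 1) := Nat.mul_pos (by omega) (by omega)
        exact_mod_cast this
      push_cast [← Finset.mul_sum] at *
      linarith
    have h1 : h 1 = 0 := by simp [h]
    have hev : ∀ᶠ u in nhdsWithin (1 : ℝ) (Set.Iio 1), h u < 0 := by
      have hs := (hasDerivAt_iff_tendsto_slope_left_right.mp hd).1
      filter_upwards [hs.eventually (lt_mem_nhds hpos), self_mem_nhdsWithin] with u hu hu1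
      rw [slope_def_field, h1, sub_zero] at hu
      have : u - 1 < 0 := sub_neg.mpr hu1
      by_contra! hcon
      exact absurd hu (not_lt.mpr (div_nonpos_of_nonneg_of_nonpos hcon this.le))
    have hev' : ∀ᶠ u in nhdsWithin (1 : ℝ) (Set.Iio 1), 0 < u :=
      nhdsWithin_le_nhds (lt_mem_nhds one_pos)
    obtain ⟨u, ⟨hu, hu0⟩, hu1⟩ := ((hev.and hev').and self_mem_nhdsWithin).exists
    exact ⟨u, hu0, hu1, sub_neg.mp hu⟩
  set g : ℝ := ∑ a ∈ range q, u ^ (3 * a) / u ^ (q - 1) with hg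
  have hupos : 0 < u ^ (q - 1) := pow_pos hu0 _
  have hbound : ∀ n, (#(lowMonomials q n) : ℝ) ≤ g ^ n := by
    intro n
    calc (#(lowMonomials q n) : ℝ) = ∑ a ∈ lowMonomials q n, (1 : ℝ) := by simp
      _ ≤ ∑ a ∈ lowMonomials q n, ∏ i, u ^ (3 * a i) / u ^ (q - 1) := by
        refine Finset.sum_le_sum fun a ha => ?_
        rw [Finset.prod_div_distrib, Finset.prod_pow_eq_pow_sum, Finset.prod_const, ← pow_mul,
          one_le_div (pow_pos hu0 _), ← Finset.mul_sum]
        refine pow_le_pow_of_le_one hu0.le hu1.le ?_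
        simpa using (mem_filter.mp ha).2
      _ ≤ ∑ a ∈ Fintype.piFinset fun _ : Fin n => range q, ∏ i, u ^ (3 * a i) / u ^ (q - 1) := by
        refine Finset.sum_le_sum_of_subset_of_nonneg (filter_subset _ _) fun a _ _ => ?_
        positivity
      _ = g ^ n := by
        rw [← Finset.prod_univ_sum (fun _ => range q) fun _ a => u ^ (3 * a) / u ^ (q - 1)]
        simp [hg]
  refine ⟨g, ?_, ?_, hbound⟩
  · have h1 := hbound 1
    have h2 := one_le_card_lowMonomials (zero_lt_one.trans hq) 1
    rw [pow_one] at h1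
    exact le_trans (by exact_mod_cast h2) h1
  · rw [hg, ← Finset.sum_div, div_lt_iff₀ hupos]
    exact hu

end LinSys

/-! ### Popular sums and rare partners -/

namespace LinSys
open Finset

/-- A directed graph with all out-degrees at most `K` has a large independent set. -/
theorem exists_independent_of_outdegree_le {α : Type*} [DecidableEq α] (r : α → α → Prop)
    [DecidableRel r] (K : ℕ) (Z : Finset α) (hZ : ∀ a ∈ Z, #{w ∈ Z | r a w} ≤ K) :
    ∃ I ⊆ Z, (∀ a ∈ I, ∀ w ∈ I, a ≠ w → ¬ r a w) ∧ #Z ≤ (2 * K + 1) * #I := by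
  induction Z using Finset.strongInduction with
  | H Z ih =>
    rcases Z.eq_empty_or_nonempty with rfl | hne
    · exact ⟨∅, subset_rfl, by simp, by simp⟩
    -- In-degrees and out-degrees have the same sum, so some `v` has in-degree at most `K`; putting
    -- `v` into the independent set costs at most `2 * K` neighbours.
    obtain ⟨v, hv, hvK⟩ : ∃ v ∈ Z, #{a ∈ Z | r a v} ≤ K := by
      refine Finset.exists_le_of_sum_le hne ?_
      exact (Finset.sum_card_bipartiteAbove_eq_sum_card_bipartiteBelow r (s := Z) (t := Z)).symm.trans_le
        (Finset.sum_le_sum hZ)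
    set Z' : Finset α := {w ∈ Z | w ≠ v ∧ ¬ r v w ∧ ¬ r w v} with hZ'
    have hsub : Z' ⊆ Z := filter_subset _ _
    have hlt : Z' ⊂ Z := (Finset.ssubset_iff_of_subset hsub).mpr ⟨v, hv, by simp [hZ']⟩
    obtain ⟨I, hIZ, hI, hcard⟩ := ih Z' hlt fun a ha =>
      (card_le_card (filter_subset_filter _ hsub)).trans (hZ a (hsub ha))
    have hIp : ∀ a ∈ I, a ≠ v ∧ ¬ r v a ∧ ¬ r a v := fun a ha =>
      (mem_filter.mp (hIZ ha)).2
    refine ⟨insert v I, insert_subset hv (hIZ.trans hsub), ?_, ?_⟩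
    · intro a ha w hw haw
      rw [mem_insert] at ha hw
      rcases ha with rfl | ha <;> rcases hw with rfl | hw
      · exact absurd rfl haw
      · exact (hIp w hw).2.1
      · exact (hIp a ha).2.2
      · exact hI a ha w hw haw
    · have hcover : Z ⊆ insert v (Z' ∪ ({w ∈ Z | r v w} ∪ {w ∈ Z | r w v})) := by
        intro w hw
        simp only [mem_insert, mem_union, mem_filter, hZ', hw, true_and]
        tauto
      have h1 := (card_le_card hcover).trans (card_insert_le _ _)
      have h2 := card_union_le Z' ({w ∈ Z | r v w} ∪ {w ∈ Z | r w v})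
      have h3 := card_union_le {w ∈ Z | r v w} {w ∈ Z | r w v}
      have h4 := hZ v hv
      rw [card_insert_of_notMem fun h => (hIp v h).1 rfl]
      linarith

section Popularity

variable {F V : Type*} [Field F] [AddCommGroup V] [Module F V] [DecidableEq V]

/-- The number of representations of `u` as `v + s • w` with `v, w ∈ S`. -/
def repCount (S : Finset V) (s : F) (u : V) : ℕ := #{w ∈ S | u - s • w ∈ S}

theorem repCount_mono {S Z : Finset V} (h : Z ⊆ S) (s : F) (u : V) :
    repCount Z s u ≤ repCount S s u := by
  refine card_le_card fun w hw => ?_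
  rw [mem_filter] at hw ⊢
  exact ⟨h hw.1, h hw.2⟩

/-- The elements `x` of `S` for which `x + s • a` has fewer than `K` representations. -/
def rarePartners (S : Finset V) (s : F) (K : ℕ) (a : V) : Finset V :=
  {x ∈ S | repCount S s (x + s • a) < K}

/-- Group the pairs `(a, x)` by `u = x + s • a`: an unpopular `u` arises from fewer than `K` pairs,
a popular one from none. -/
theorem sum_card_rarePartners_le [Fintype V] (S : Finset V) (s : F) (K : ℕ) (U : Finset V)
    (hU : U ⊆ S) : ∑ a ∈ U, #(rarePartners S s K a) ≤ K * Fintype.card V := by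
  rw [← card_sigma, ← card_univ]
  refine card_le_mul_card_image_of_maps_to (f := fun p : (_ : V) × V => p.2 + s • p.1)
    (fun _ _ => mem_univ _) K fun u _ => ?_
  by_cases hu : repCount S s u < K
  · refine le_trans ?_ hu.le
    refine card_le_card_of_injOn (fun p => p.1) ?_ ?_
    · rintro ⟨a, x⟩ hp
      simp only [rarePartners, mem_filter, mem_sigma, mem_coe] at hp ⊢
      refine ⟨hU hp.1.1, ?_⟩
      rw [← hp.2, add_sub_cancel_right]
      exact hp.1.2.1
    · rintro ⟨a, x⟩ hp ⟨a', x'⟩ hp' (rfl : a = a')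
      simp only [coe_filter, Set.mem_ofPred_eq] at hp hp'
      rw [add_right_cancel (hp.2.trans hp'.2.symm)]
  · rw [filter_eq_empty_iff.mpr]
    · simp
    · rintro ⟨a, x⟩ hp rfl
      simp only [rarePartners, mem_filter, mem_sigma] at hp
      exact hu hp.2.2

/-- Markov's inequality applied to the preceding double count. -/
theorem card_many_rarePartners_mul_le [Fintype V] (S : Finset V) (s : F) (K M : ℕ) :
    #{a ∈ S | M < #(rarePartners S s K a)} * M ≤ K * Fintype.card V := by
  refine le_trans ?_ (sum_card_rarePartners_le S s K
    {a ∈ S | M < #(rarePartners S s K a)} (filter_subset _ S))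
  rw [← smul_eq_mul]
  refine card_nsmul_le_sum _ _ _ fun a ha => ?_
  exact (mem_filter.mp ha).2.le

end Popularity

/-- Join `a` to `w` when `a + s • a - s • w ∈ Z`. Out-degrees are representation counts, and an
independent set has only trivial solutions of `x + s y = (1 + s) z`. -/
theorem card_le_of_repCount_le {F : Type*} [Field F] [Fintype F] [DecidableEq F] {n : ℕ}
    (Z : Finset (Fin n → F)) (s : F) (K : ℕ) (hZ : ∀ a ∈ Z, repCount Z s (a + s • a) ≤ K) :
    #Z ≤ (2 * K + 1) * (3 * #(lowMonomials (Fintype.card F) n)) := by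
  obtain ⟨I, hIZ, hI, hcard⟩ :=
    exists_independent_of_outdegree_le (fun a w => a + s • a - s • w ∈ Z) K Z hZ
  refine hcard.trans (Nat.mul_le_mul_left _ ?_)
  -- A solution has `x = z + s • z - s • y ∈ Z`, an edge from `z` to `y`, so independence forces `y
  -- = z` and then `x = z`. This also covers `s = -1`.
  refine card_le_three_mul_lowMonomials ![1, s, -(1 + s)] I fun x hx y hy z hz => ?_
  simp only [Matrix.cons_val, one_smul]
  constructor
  · intro h
    have hx' : x = z + s • z - s • y := by
      rw [← sub_eq_zero, ← h]
      module
    have hzy : z = y := by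
      by_contra hne
      exact hI z hz y hy hne (hx' ▸ hIZ hx)
    subst hzy
    refine ⟨?_, rfl⟩
    rw [hx']
    module
  · rintro ⟨rfl, rfl⟩
    module

end LinSys

/-! ### Making a tuple generic, one pair at a time -/

namespace LinSys
open Finset

variable {F V κ : Type*} [Field F] [AddCommGroup V] [Module F V]

theorem sum_smul_add_single_add_single [Fintype κ] [DecidableEq κ] (b : κ → F) (x : κ → V)
    (i j : κ) (v w : V) :
    ∑ l, b l • (x + Pi.single i v + Pi.single j w : κ → V) l =
      ∑ l, b l • x l + b i • v + b j • w := by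
  simp [smul_add, Finset.sum_add_distrib, Pi.single_apply, smul_ite]

/-- Starting from a tuple in which every pair `(ρ j, j)` has a value `x (ρ j) + s j • x j` with many
representations, one can modify the tuple within `S`, one pair at a time, so that exactly those
equations survive in which the coefficients of each pair have the ratio `s j`. -/
theorem exists_generic_modification [Fintype F] [Fintype κ] [DecidableEq κ] [DecidableEq V]
    (S : Finset V) (ρ : κ → κ) (s : κ → F) (hs : ∀ j, s j ≠ 0) (K M : ℕ → ℕ) (hKmono : Monotone K)
    (hKM : ∀ i, Fintype.card (κ → F) + Fintype.card κ * M i < K (i + 1))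
    (T : Finset κ) (hρ : ∀ j ∈ T, ρ j ∉ T) (x : κ → V) (hx : ∀ j, x j ∈ S)
    (hclean : ∀ j ∈ T, ∀ i < #T, #(rarePartners S (s j) (K i) (x j)) ≤ M i)
    (hrep : ∀ j ∈ T, K #T ≤ repCount S (s j) (x (ρ j) + s j • x j)) :
    ∃ x' : κ → V, (∀ j, x' j ∈ S) ∧
      (∀ b : κ → F, (∀ j ∈ T, b j = s j * b (ρ j)) → ∑ j, b j • x' j = ∑ j, b j • x j) ∧
      ∀ b : κ → F, (∃ j ∈ T, b j ≠ s j * b (ρ j)) → ∑ j, b j • x' j ≠ 0 := by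
  classical
  induction T using Finset.induction_on generalizing x with
  | empty => exact ⟨x, hx, by simp, by simp⟩
  | insert j T hjT ih =>
    have hρj : ρ j ≠ j := fun h =>
      hρ j (mem_insert_self _ _) (h.symm ▸ mem_insert_self j T : ρ j ∈ insert j T)
    rw [card_insert_of_notMem hjT] at hclean hrep
    set u := x (ρ j) + s j • x j with hu
    -- The admissible new values of `x j`: the sum `u` stays fixed and both entries stay in `S`.
    let W : Finset V := {w ∈ S | u - s j • w ∈ S}
    let y : V → κ → V := fun w =>
      x + Pi.single j (w - x j) + Pi.single (ρ j) (u - s j • w - x (ρ j))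
    have hyj : ∀ w, y w j = w := fun w => by simp [y, hρj.symm]
    have hyρ : ∀ w, y w (ρ j) = u - s j • w := fun w => by simp [y, hρj]
    have hy : ∀ w l, l ≠ j → l ≠ ρ j → y w l = x l := fun w l h1 h2 => by simp [y, h1, h2]
    have hsum : ∀ (b : κ → F) w,
        ∑ l, b l • y w l = ∑ l, b l • x l + (b j - s j * b (ρ j)) • (w - x j) := fun b w => by
      rw [sum_smul_add_single_add_single, hu]
      module
    -- `B₁ l` holds the `w` that would spoil the popularity needed later for a pair `l` with the
    -- same representative; they inject into the rare partners of `x l`. `B₂ b` holds the `w` for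
    -- which an equation of wrong ratio at `j` survives, at most one by `hsum`.
    let B₁ : κ → Finset V := fun l =>
      {w ∈ W | repCount S (s l) (u - s j • w + s l • x l) < K #T}
    let B₂ : (κ → F) → Finset V := fun b =>
      {w ∈ W | b j ≠ s j * b (ρ j) ∧ ∑ l, b l • y w l = 0}
    have hB₁ : ∀ l ∈ T, #(B₁ l) ≤ M #T := by
      intro l hl
      refine le_trans ?_ (hclean l (mem_insert_of_mem hl) #T (Nat.lt_succ_self _))
      refine card_le_card_of_injOn (fun w => u - s j • w) ?_ ?_
      · intro w hw
        simp only [B₁, W, mem_coe, mem_filter, rarePartners] at hw ⊢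
        exact ⟨hw.1.2, hw.2⟩
      · intro w _ w' _ h
        exact smul_right_injective V (hs j) (sub_right_injective h)
    have hB₂ : ∀ b, #(B₂ b) ≤ 1 := by
      intro b
      refine card_le_one.mpr fun w hw w' hw' => ?_
      simp only [B₂, mem_filter, hsum] at hw hw'
      have h := add_left_cancel (hw.2.2.trans hw'.2.2.symm)
      exact sub_left_injective (smul_right_injective V (sub_ne_zero.mpr hw.2.1) h)
    have hbad : #(T.biUnion B₁ ∪ univ.biUnion B₂) < #W := by
      calc #(T.biUnion B₁ ∪ univ.biUnion B₂) ≤ #T * M #T + #(univ : Finset (κ → F)) * 1 :=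
            (card_union_le _ _).trans (add_le_add (card_biUnion_le_card_mul _ _ _ hB₁)
              (card_biUnion_le_card_mul _ _ _ fun b _ => hB₂ b))
        _ ≤ Fintype.card (κ → F) + Fintype.card κ * M #T := by
            rw [mul_one, card_univ, add_comm]
            gcongr
            exact card_le_univ T
        _ < K (#T + 1) := hKM _
        _ ≤ #W := hrep j (mem_insert_self _ _)
    obtain ⟨w, hwW, hw⟩ := exists_mem_notMem_of_card_lt_card hbad
    simp only [mem_union, mem_biUnion, not_or, not_exists, not_and, mem_univ, true_and] at hw
    obtain ⟨hw₁, hw₂⟩ := hw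
    have hwS := mem_filter.mp hwW
    have hTne : ∀ l ∈ T, l ≠ j ∧ l ≠ ρ j := fun l hl =>
      ⟨fun h => hjT (h ▸ hl), fun h => hρ j (mem_insert_self _ _) (mem_insert_of_mem (h ▸ hl))⟩
    obtain ⟨x', hx', hx'1, hx'2⟩ := ih
      (fun l hl h => hρ l (mem_insert_of_mem hl) (mem_insert_of_mem h)) (y w)
      (fun l => by
        by_cases h1 : l = j
        · rw [h1, hyj]; exact hwS.1
        by_cases h2 : l = ρ j
        · rw [h2, hyρ]; exact hwS.2
        rw [hy w l h1 h2]
        exact hx l)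
      (fun l hl i hi => by
        rw [hy w l (hTne l hl).1 (hTne l hl).2]
        exact hclean l (mem_insert_of_mem hl) i (hi.trans (Nat.lt_succ_self _)))
      (fun l hl => by
        rw [hy w l (hTne l hl).1 (hTne l hl).2]
        -- Only pairs sharing the representative `ρ j` are affected. They keep popularity at the
        -- next lower threshold, which is all the induction needs.
        by_cases h : ρ l = ρ j
        · rw [h, hyρ]
          have := hw₁ l hl
          simp only [B₁, mem_filter, hwW, true_and, not_lt] at this
          exact this
        · rw [hy w (ρ l) (fun h' => hρ l (mem_insert_of_mem hl) (h' ▸ mem_insert_self _ _)) h]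
          exact (hKmono (Nat.le_succ _)).trans (hrep l (mem_insert_of_mem hl)))
    refine ⟨x', hx', fun b hb => ?_, fun b hb => ?_⟩
    · rw [hx'1 b fun l hl => hb l (mem_insert_of_mem hl), hsum, hb j (mem_insert_self _ _)]
      simp
    · by_cases hbT : ∃ l ∈ T, b l ≠ s l * b (ρ l)
      · exact hx'2 b hbT
      · push Not at hbT
        rw [hx'1 b hbT]
        have hbj : b j ≠ s j * b (ρ j) := by
          obtain ⟨l, hl, hne⟩ := hb
          rcases mem_insert.mp hl with rfl | hl
          · exact hne
          · exact absurd (hbT l hl) hne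
        have := hw₂ b
        simp only [B₂, mem_filter, hwW, true_and, not_and] at this
        exact this hbj

end LinSys

/-! ### Rich points -/

namespace LinSys
open Finset

variable {F V κ : Type*} [Field F] [AddCommGroup V] [Module F V] [DecidableEq V] [Fintype κ]

open Classical in
/-- The elements `a` of `S` that have few rare partners, for each of the thresholds `K i`, and for
which `a + s j • a` has many representations. -/
noncomputable def richPoints (S : Finset V) (s : κ → F) (K M : ℕ → ℕ) : Finset V :=
  {a ∈ S | (∀ j, ∀ i ∈ range (Fintype.card κ + 1), #(rarePartners S (s j) (K i) a) ≤ M i) ∧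
    ∀ j, K (Fintype.card κ) ≤ repCount S (s j) (a + s j • a)}

theorem mem_richPoints {S : Finset V} {s : κ → F} {K M : ℕ → ℕ} {a : V} :
    a ∈ richPoints S s K M ↔ a ∈ S ∧
      (∀ j, ∀ i ∈ range (Fintype.card κ + 1), #(rarePartners S (s j) (K i) a) ≤ M i) ∧
      ∀ j, K (Fintype.card κ) ≤ repCount S (s j) (a + s j • a) := by
  simp only [richPoints, mem_filter]

/-- Union bound: with `k = card κ`, each of the `k * (k + 1)` sets of points with many rare partners
has at most `#S / (4 * (k + 1) ^ 2)` elements, and each of the `k` sets with unpopular `a + s j • a`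
at most `#S / (4 * (k + 1))`. -/
theorem card_le_two_mul_card_richPoints [Fintype V] (S : Finset V) (s : κ → F) (K M : ℕ → ℕ)
    (R : ℕ) (hR : Fintype.card V ≤ R * #S) (hR0 : 0 < R) (hK0 : ∀ i, 0 < K i)
    (hM : ∀ i, M i = 4 * (Fintype.card κ + 1) ^ 2 * (R * K i))
    (hdiag : ∀ j, 4 * (Fintype.card κ + 1) *
      #{a ∈ S | repCount S (s j) (a + s j • a) < K (Fintype.card κ)} ≤ #S) :
    #S ≤ 2 * #(richPoints S s K M) := by
  classical
  set k := Fintype.card κ with hk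
  set Z : κ → Finset V := fun j => {a ∈ S | repCount S (s j) (a + s j • a) < K k} with hZ
  set U : κ × ℕ → Finset V := fun p =>
    {a ∈ S | M p.2 < #(rarePartners S (s p.1) (K p.2) a)} with hU
  have hUcard : ∀ p, 4 * (k + 1) ^ 2 * #(U p) ≤ #S := by
    intro p
    have h1 := card_many_rarePartners_mul_le S (s p.1) (K p.2) (M p.2)
    have hpos : 0 < R * K p.2 := Nat.mul_pos hR0 (hK0 _)
    refine Nat.le_of_mul_le_mul_right ?_ hpos
    calc 4 * (k + 1) ^ 2 * #(U p) * (R * K p.2) = #(U p) * M p.2 := by rw [hM]; ring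
      _ ≤ K p.2 * Fintype.card V := h1
      _ ≤ K p.2 * (R * #S) := Nat.mul_le_mul_left _ hR
      _ = #S * (R * K p.2) := by ring
  have hcover : S ⊆ richPoints S s K M ∪
      ((univ ×ˢ range (k + 1)).biUnion U ∪ univ.biUnion Z) := by
    intro a ha
    simp only [mem_union, mem_biUnion, mem_richPoints, mem_filter, ha, true_and, mem_product, mem_univ,
      hU, hZ]
    by_cases h1 : ∀ j, ∀ i ∈ range (k + 1), #(rarePartners S (s j) (K i) a) ≤ M i
    · by_cases h2 : ∀ j, K k ≤ repCount S (s j) (a + s j • a)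
      · exact Or.inl ⟨h1, h2⟩
      · push Not at h2
        exact Or.inr (Or.inr h2)
    · push Not at h1
      obtain ⟨j, i, hi, h⟩ := h1
      exact Or.inr (Or.inl ⟨(j, i), hi, h⟩)
  have h1 := (card_le_card hcover).trans (card_union_le _ _)
  have h2 := card_union_le ((univ ×ˢ range (k + 1)).biUnion U) (univ.biUnion Z)
  have h3 : 4 * (k + 1) ^ 2 * #((univ ×ˢ range (k + 1)).biUnion U) ≤ k * (k + 1) * #S := by
    calc _ ≤ 4 * (k + 1) ^ 2 * ∑ p ∈ univ ×ˢ range (k + 1), #(U p) :=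
          Nat.mul_le_mul_left _ card_biUnion_le
      _ = ∑ p ∈ univ ×ˢ range (k + 1), 4 * (k + 1) ^ 2 * #(U p) := mul_sum _ _ _
      _ ≤ ∑ p ∈ (univ : Finset κ) ×ˢ range (k + 1), #S := sum_le_sum fun p _ => hUcard p
      _ = _ := by simp [hk]
  have h4 : 4 * (k + 1) ^ 2 * #(univ.biUnion Z) ≤ k * (k + 1) * #S := by
    calc _ ≤ 4 * (k + 1) ^ 2 * ∑ j, #(Z j) := Nat.mul_le_mul_left _ card_biUnion_le
      _ = (k + 1) * ∑ j, 4 * (k + 1) * #(Z j) := by rw [mul_sum, mul_sum]; congr 1; ext; ring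
      _ ≤ (k + 1) * ∑ j : κ, #S := Nat.mul_le_mul_left _ (sum_le_sum fun j _ => hdiag j)
      _ = _ := by simp [hk]; ring
  have h5 : (k + 1) ^ 2 * #S ≤ (k + 1) ^ 2 * (2 * #(richPoints S s K M)) := by
    nlinarith
  exact Nat.le_of_mul_le_mul_left h5 (by positivity)

/-- If the set of rich points is large, there are two tuples of rich points whose difference is a
nonzero multiple of a prescribed vector `t` and which have many representations where needed. -/
theorem exists_rich_pair [Fintype V] [DecidableEq κ] (S : Finset V) (ρ : κ → κ) (s : κ → F)
    (K M : ℕ → ℕ) (t : κ → F) (r₀ : κ) (ht : t r₀ = 1)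
    (hcard : Fintype.card V ^ (Fintype.card κ - 1) *
      (1 + Fintype.card κ * M (Fintype.card κ)) < #(richPoints S s K M) ^ Fintype.card κ) :
    ∃ (p p' : κ → V) (y : V), (∀ j, p j ∈ richPoints S s K M) ∧
      (∀ j, p' j ∈ richPoints S s K M) ∧ y ≠ 0 ∧ (∀ j, p j = p' j + t j • y) ∧
      ∀ j, K (Fintype.card κ) ≤ repCount S (s j) (p (ρ j) + s j • p' (ρ j)) := by
  classical
  set k := Fintype.card κ with hk
  set S' := richPoints S s K M with hS'
  -- Two tuples in one fibre of `φ` differ by a multiple of `t`. As `t r₀ = 1`, the image has zero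
  -- entry at `r₀`, which saves one factor `card V` in the pigeonhole.
  let φ : (κ → V) → κ → V := fun p j => p j - t j • p r₀
  let G : Finset (κ → V) := Fintype.piFinset fun j => if j = r₀ then {0} else univ
  have hG : #G = Fintype.card V ^ (k - 1) := by
    rw [Fintype.card_piFinset, ← mul_prod_erase _ _ (mem_univ r₀)]
    simp only [if_true, card_singleton, one_mul]
    rw [prod_congr rfl fun j hj => by rw [if_neg (ne_of_mem_erase hj), card_univ]]
    simp [hk]
  obtain ⟨g, -, hg⟩ := exists_lt_card_fiber_of_mul_lt_card_of_maps_to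
    (s := Fintype.piFinset fun _ : κ => S') (t := G) (f := φ) (n := 1 + k * M k)
    (fun p _ => by
      simp only [G, Fintype.mem_piFinset, φ]
      intro j
      split_ifs with h
      · simp [h, ht]
      · exact mem_univ _)
    (by rw [hG, Fintype.card_piFinset, prod_const, card_univ]; exact hcard)
  set P : Finset (κ → V) := {p ∈ Fintype.piFinset fun _ : κ => S' | φ p = g} with hP
  have hmem : ∀ p ∈ P, (∀ j, p j ∈ S') ∧ ∀ j, p j - t j • p r₀ = g j := fun p hp => by
    rw [hP, mem_filter, Fintype.mem_piFinset] at hp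
    exact ⟨hp.1, fun j => congrFun hp.2 j⟩
  obtain ⟨p', hp'⟩ : P.Nonempty := card_pos.mp (by omega)
  have hdiff : ∀ p ∈ P, ∀ j, p j = p' j + t j • (p r₀ - p' r₀) := fun p hp j => by
    have h1 := (hmem p hp).2 j
    have h2 := (hmem p' hp').2 j
    rw [← h2] at h1
    rw [smul_sub, ← sub_eq_zero]
    rw [← sub_eq_zero] at h1
    rw [← h1]
    abel
  -- The threshold of index `k` itself is used here, hence `range (card κ + 1)` in `richPoints`.
  have hrich : ∀ a ∈ S', (∀ j, #(rarePartners S (s j) (K k) a) ≤ M k) ∧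
      ∀ j, K k ≤ repCount S (s j) (a + s j • a) := fun a ha => by
    have := (mem_richPoints.mp ha).2
    exact ⟨fun j => this.1 j k (by simp [hk]), this.2⟩
  have hsub : ∀ a ∈ S', a ∈ S := fun a ha => (mem_richPoints.mp ha).1
  -- Within the fibre, `p` is determined by `p (ρ j)` if `t (ρ j) ≠ 0`, so each rare partner
  -- excludes one tuple. If `t (ρ j) = 0`, then `p (ρ j) = p' (ρ j)` and popularity on the diagonal
  -- suffices. Excluding `p'` as well gives `y ≠ 0`.
  let B : κ → Finset (κ → V) := fun j =>
    {p ∈ P | t (ρ j) ≠ 0 ∧ p (ρ j) ∈ rarePartners S (s j) (K k) (p' (ρ j))}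
  have hB : ∀ j ∈ (univ : Finset κ), #(B j) ≤ M k := by
    intro j _
    refine le_trans ?_ ((hrich _ ((hmem p' hp').1 (ρ j))).1 j)
    refine card_le_card_of_injOn (fun p => p (ρ j)) ?_ ?_
    · intro p hp
      exact (mem_filter.mp hp).2.2
    · intro p hp r hr (hpr : p (ρ j) = r (ρ j))
      simp only [B, mem_coe, mem_filter] at hp hr
      rw [hdiff p hp.1, hdiff r hr.1] at hpr
      have h := smul_right_injective V hp.2.1 (add_left_cancel hpr)
      funext i
      rw [hdiff p hp.1, hdiff r hr.1]
      exact congrArg (fun v => p' i + t i • v) h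
  have hlt : #({p'} ∪ univ.biUnion B) < #P := by
    refine lt_of_le_of_lt ((card_union_le _ _).trans (add_le_add (card_singleton _).le
      (card_biUnion_le_card_mul _ _ _ hB))) ?_
    rw [card_univ]
    exact hg
  obtain ⟨p, hp, hpB⟩ := exists_mem_notMem_of_card_lt_card hlt
  simp only [mem_union, mem_singleton, mem_biUnion, mem_univ, true_and, not_or, not_exists] at hpB
  refine ⟨p, p', p r₀ - p' r₀, (hmem p hp).1, (hmem p' hp').1, fun h => hpB.1 ?_, hdiff p hp,
    fun j => ?_⟩
  · funext j
    rw [hdiff p hp, h, smul_zero, add_zero]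
  · by_cases h0 : t (ρ j) = 0
    · rw [hdiff p hp, h0, zero_smul, add_zero]
      exact (hrich _ ((hmem p' hp').1 (ρ j))).2 j
    · have := hpB.2 j
      simp only [B, mem_filter, hp, true_and, h0, ne_eq, not_false_eq_true, rarePartners,
        hsub _ ((hmem p hp).1 _), not_lt] at this
      exact this

end LinSys

/-! ### Column classes, relations and affine dimension -/

namespace LinSys

section Columns

variable {F : Type*} [Field F] {ι κ V : Type*}

/-- Nonzero columns make the scalar of a representative relative to itself equal to `1`. -/
theorem exists_column_representatives (A : Matrix ι κ F) (hA : ∀ j, ∃ i, A i j ≠ 0) :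
    ∃ (ρ : κ → κ) (s : κ → F), (∀ j, s j ≠ 0) ∧ (∀ i j, A i j = s j * A i (ρ j)) ∧
      (∀ j, ρ (ρ j) = ρ j) ∧ (∀ j, ρ j = j → s j = 1) ∧
      ∀ j j', colSetoid A j j' ↔ ρ j = ρ j' := by
  let ρ : κ → κ := fun j => (Quotient.mk (colSetoid A) j).out
  have hρ : ∀ j, colSetoid A j (ρ j) := fun j => (colSetoid A).symm (Quotient.mk_out (s := colSetoid A) j)
  choose s hs0 hs using hρ
  have hiff : ∀ j j', colSetoid A j j' ↔ ρ j = ρ j' := by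
    intro j j'
    simp only [ρ]
    rw [Quotient.out_inj]
    exact Quotient.eq.symm
  refine ⟨ρ, s, hs0, fun i j => hs j i, fun j => ?_, fun j hj => ?_, hiff⟩
  · exact ((hiff _ _).mp ⟨s j, hs0 j, hs j⟩).symm
  · obtain ⟨i, hi⟩ := hA j
    have h := hs j i
    rw [hj] at h
    exact (mul_right_cancel₀ hi (by rw [one_mul]; exact h)).symm

/-- The new row scales within each class exactly as the rows of `A` do, so equivalent columns remain
so; an added row can never merge classes. -/
theorem preservesColClasses_of_ratio (A : Matrix ι κ F) (ρ : κ → κ) (s : κ → F) (hs : ∀ j, s j ≠ 0) (hAs : ∀ i j, A i j = s j * A i (ρ j))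
    (hρ : ∀ j j', colSetoid A j j' ↔ ρ j = ρ j') (b : κ → F) (hb : ∀ j, b j = s j * b (ρ j)) :
    PreservesColClasses A b := by
  have : colSetoid (appendEq A b) = colSetoid A := by
    refine Setoid.ext fun j j' => ⟨?_, fun h => ?_⟩
    · rintro ⟨c, hc, h⟩
      exact ⟨c, hc, fun i => h (Sum.inl i)⟩
    · have hjj := (hρ j j').mp h
      refine ⟨s j / s j', div_ne_zero (hs j) (hs j'), ?_⟩
      have key : ∀ v : κ → F, (∀ l, v l = s l * v (ρ l)) → v j = s j / s j' * v j' := by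
        intro v hv
        rw [hv j, hv j', hjj]
        field_simp [hs j']
      rintro (i | i)
      · exact key (A i) (hAs i)
      · exact key b hb
  rw [PreservesColClasses, colClasses, colClasses, this]

/-- The equations in which the coefficients have ratio `s j` within each class of `ρ`. -/
def ratioSubmodule (ρ : κ → κ) (s : κ → F) : Submodule F (κ → F) where
  carrier := {b | ∀ j, b j = s j * b (ρ j)}
  add_mem' := fun {a b} ha hb j => by
    rw [Pi.add_apply, Pi.add_apply, ha j, hb j, mul_add]
  zero_mem' := fun j => by simp
  smul_mem' := fun c b hb j => by
    rw [Pi.smul_apply, Pi.smul_apply, hb j, smul_eq_mul, smul_eq_mul, mul_left_comm]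

/-- A vector of the submodule is determined by its values at the representatives, one for each
class. -/
theorem finrank_ratioSubmodule_le [Finite κ] (A : Matrix ι κ F) (ρ : κ → κ) (s : κ → F)
    (hρ : ∀ j j', colSetoid A j j' ↔ ρ j = ρ j') :
    Module.finrank F (ratioSubmodule ρ s) ≤ numColClasses A := by
  have : Fintype (Quotient (colSetoid A)) := Fintype.ofFinite _
  let f : ratioSubmodule ρ s →ₗ[F] (Quotient (colSetoid A) → F) :=
    (LinearMap.funLeft F F (Quotient.lift ρ fun a b h => (hρ a b).mp h)).comp
      (ratioSubmodule ρ s).subtype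
  have hf : Function.Injective f := by
    intro b b' h
    refine Subtype.ext (funext fun j => ?_)
    have := congrFun h (Quotient.mk _ j)
    rw [b.2 j, b'.2 j]
    exact congrArg (s j * ·) this
  have h1 := LinearMap.finrank_le_finrank_of_injective hf
  rw [Module.finrank_fintype_fun_eq_card] at h1
  refine h1.trans_eq ?_
  rw [numColClasses, colClasses, Set.ncard, ← Nat.card_eq_fintype_card, Set.encard]
  exact Nat.card_congr (Setoid.quotientEquivClasses _)

/-- The balanced equations satisfied by the tuple `x`. -/
def balancedRelations [Fintype κ] [AddCommGroup V] [Module F V] (x : κ → V) :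
    Submodule F (κ → F) where
  carrier := {b | BalancedEq b ∧ Satisfies b x}
  add_mem' := fun {a b} ha hb => by
    simp only [BalancedEq, Satisfies, Set.mem_ofPred_eq, Pi.add_apply, add_smul,
      Finset.sum_add_distrib] at *
    simp [ha, hb]
  zero_mem' := by simp [BalancedEq, Satisfies]
  smul_mem' := fun c b hb => by
    simp only [BalancedEq, Satisfies, Set.mem_ofPred_eq, Pi.smul_apply, smul_eq_mul, mul_smul,
      ← Finset.mul_sum, ← Finset.smul_sum] at *
    simp [hb]

/-- Rank–nullity for `b ↦ ∑ j, b j • x j` on the coefficient vectors of sum zero, a space of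
dimension at least `card κ - 1`: the image lies in the direction of the affine hull, the kernel
consists of balanced relations. -/
theorem card_le_affDim_add_finrank [Fintype κ] [AddCommGroup V] [Module F V]
    [FiniteDimensional F V] (x : κ → V) :
    Fintype.card κ ≤ affDim (F := F) x + Module.finrank F (balancedRelations (F := F) x) + 1 := by
  classical
  let σ : (κ → F) →ₗ[F] F := ∑ j, LinearMap.proj j
  let Φ : (κ → F) →ₗ[F] V := Fintype.linearCombination F x
  have h1 := LinearMap.finrank_range_add_finrank_ker σ
  have h2 : Module.finrank F (LinearMap.range σ) ≤ 1 :=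
    (Submodule.finrank_le _).trans_eq (Module.finrank_self F)
  rw [Module.finrank_fintype_fun_eq_card] at h1
  have h3 := LinearMap.finrank_range_add_finrank_ker (Φ.domRestrict (LinearMap.ker σ))
  have h4 : Module.finrank F (LinearMap.range (Φ.domRestrict (LinearMap.ker σ))) ≤
      affDim (F := F) x := by
    refine Submodule.finrank_mono ?_
    rintro _ ⟨⟨b, hb⟩, rfl⟩
    have hb' : ∑ j, b j = 0 := by simpa [σ] using LinearMap.mem_ker.mp hb
    have := weightedVSub_mem_vectorSpan (k := F) (s := Finset.univ) hb' x
    rw [direction_affineSpan]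
    rw [Finset.weightedVSub_eq_weightedVSubOfPoint_of_sum_eq_zero _ _ _ hb' (0 : V)] at this
    simpa [Φ, Fintype.linearCombination_apply, Finset.weightedVSubOfPoint_apply] using this
  have h5 : Module.finrank F (LinearMap.ker (Φ.domRestrict (LinearMap.ker σ))) ≤
      Module.finrank F (balancedRelations (F := F) x) := by
    rw [← Submodule.finrank_map_subtype_eq]
    refine Submodule.finrank_mono ?_
    rintro _ ⟨⟨b, hb⟩, hbΦ, rfl⟩
    have hb' : ∑ j, b j = 0 := by simpa [σ] using LinearMap.mem_ker.mp hb
    refine ⟨hb', ?_⟩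
    have := LinearMap.mem_ker.mp hbΦ
    simpa [Φ, Fintype.linearCombination_apply, Satisfies] using this
  omega

end Columns

/-- In an irreducible system with at least two column classes, representatives of the column classes
are linearly dependent. -/
theorem Irreducible.exists_dependence {F : Type*} [Field F] {ι κ : Type*} [Fintype ι] [Fintype κ]
    {A : Matrix ι κ F} (hA : Irreducible A) (ρ : κ → κ) (s : κ → F)
    (hAs : ∀ i j, A i j = s j * A i (ρ j)) (hρρ : ∀ j, ρ (ρ j) = ρ j) (j₁ j₂ : κ)
    (hne : ρ j₁ ≠ ρ j₂) :
    ∃ (t : κ → F) (r₀ : κ), ρ r₀ = r₀ ∧ t r₀ = 1 ∧ (∀ j, ρ j ≠ j → t j = 0) ∧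
      ∀ i, ∑ j, t j * A i j = 0 := by
  classical
  let f : ({j // ρ j = j} → F) →ₗ[F] (ι → F) :=
    (Matrix.of fun i (r : {j // ρ j = j}) => A i r).mulVecLin
  -- If the representative columns were independent, a left inverse of `f` would express each class
  -- vector `e r` through the rows of `A`. The `e r` would form an equivalent system split along the
  -- classes, of which there are at least two.
  by_cases hker : LinearMap.ker f = ⊥
  · exfalso
    obtain ⟨g, hg⟩ := LinearMap.exists_leftInverse_of_injective f hker
    let e : {j // ρ j = j} → κ → F := fun r j => if ρ j = r then s j else 0
    have hcol : ∀ r : {j // ρ j = j}, f (Pi.single r 1) = fun i => A i r := by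
      intro r
      ext i
      simp [f]
    have he : ∀ r, IsCombination A (e r) := by
      intro r
      have : e r = ∑ i, g (Pi.single i 1) r • A i := by
        funext j
        have h1 : g (fun i => A i (ρ j)) = Pi.single ⟨ρ j, hρρ j⟩ 1 := by
          rw [← hcol ⟨ρ j, hρρ j⟩]
          exact LinearMap.congr_fun hg _
        have h2 : (fun i => A i (ρ j)) = ∑ i, A i (ρ j) • (Pi.single i 1 : ι → F) := by
          funext i
          simp [Finset.sum_apply, Pi.single_apply]
        rw [h2, map_sum] at h1
        have h3 := congrFun h1 r
        simp only [map_smul, Finset.sum_apply, Pi.smul_apply, smul_eq_mul] at h3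
        simp only [Finset.sum_apply, Pi.smul_apply, smul_eq_mul]
        calc e r j = s j * (Pi.single (⟨ρ j, hρρ j⟩ : {j // ρ j = j}) (1 : F) : _ → F) r := by
              simp only [e, Pi.single_apply, Subtype.ext_iff, eq_comm (a := ρ j)]
              simp
          _ = _ := by
              rw [← h3, Finset.mul_sum]
              refine Finset.sum_congr rfl fun i _ => ?_
              rw [hAs i j]
              ring
      rw [IsCombination, this]
      exact Submodule.sum_mem _ fun i _ => Submodule.smul_mem _ _ (Submodule.subset_span ⟨i, rfl⟩)
    have heA : ∀ i, A i = ∑ r : {j // ρ j = j}, A i r • e r := by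
      intro i
      funext j
      simp only [Finset.sum_apply, Pi.smul_apply, smul_eq_mul]
      rw [Finset.sum_eq_single ⟨ρ j, hρρ j⟩]
      · simp [e, hAs i j, mul_comm]
      · intro r _ hr
        have : ρ j ≠ r := fun h => hr (Subtype.ext h.symm)
        simp [e, this]
      · simp
    let ε := Fintype.equivFin {j // ρ j = j}
    refine hA ⟨_, fun a => e (ε.symm a), Setoid.ker ρ, ⟨fun i => ?_, fun a => he _⟩, ?_, fun a => ?_⟩
    · change A i ∈ Submodule.span F _
      rw [heA i]
      refine Submodule.sum_mem _ fun r _ => Submodule.smul_mem _ _ (Submodule.subset_span ⟨ε r, ?_⟩)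
      simp
    · refine ⟨_, Setoid.mem_classes _ j₁, _, Setoid.mem_classes _ j₂, fun h => hne ?_⟩
      have : j₁ ∈ {x | Setoid.ker ρ x j₁} := (Setoid.ker ρ).refl j₁
      rw [h] at this
      exact this
    · refine ⟨_, Setoid.mem_classes _ (ε.symm a : κ), fun j hj => ?_⟩
      have h1 : ρ j = (ε.symm a : κ) := by
        by_contra h
        exact hj (if_neg h)
      exact h1.trans (ε.symm a).2.symm
  · obtain ⟨t, ht, ht0⟩ := Submodule.exists_mem_ne_zero_of_ne_bot hker
    obtain ⟨r, hr⟩ : ∃ r, t r ≠ 0 := by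
      by_contra! h
      exact ht0 (funext h)
    refine ⟨fun j => if h : ρ j = j then (t r)⁻¹ * t ⟨j, h⟩ else 0, r, r.2, ?_, fun j hj => ?_,
      fun i => ?_⟩
    · simp [r.2, hr]
    · simp [hj]
    · have h1 := congrFun (LinearMap.mem_ker.mp ht) i
      simp only [f, Matrix.mulVecLin_apply, Matrix.mulVec, dotProduct, Matrix.of_apply,
        Pi.zero_apply] at h1
      rw [← Finset.sum_filter_of_ne (p := fun j => ρ j = j)]
      · rw [← Finset.sum_subtype_eq_sum_filter, Finset.subtype_univ]
        calc _ = ∑ j : {j // ρ j = j}, (t r)⁻¹ * (A i j * t j) := by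
              refine Finset.sum_congr rfl fun j _ => ?_
              change (if h : ρ j = j then (t r)⁻¹ * t ⟨j, h⟩ else 0) * A i j = _
              rw [dif_pos j.2]
              ring
          _ = 0 := by rw [← Finset.mul_sum, h1, mul_zero]
      · intro j _ hj
        by_contra h
        simp [h] at hj

end LinSys

/-! ### Thresholds and the generic solution -/

namespace LinSys
open Finset

section

variable {F : Type*} [Field F] {ι κ : Type*} [Fintype κ]

theorem numColClasses_le_one {A : Matrix ι κ F} (h : ∀ j j', colSetoid A j j') :
    numColClasses A ≤ 1 := by
  rw [numColClasses, Set.ncard_le_one]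
  rintro _ ⟨y, rfl⟩ _ ⟨y', rfl⟩
  ext x
  exact ⟨fun _ => h _ _, fun _ => h _ _⟩

/-- In each coordinate, `p (ρ j)` is constant on classes, and multiplying `b` by such a function
stays in the submodule, all of whose vectors have sum zero. -/
theorem sum_smul_comp_eq_zero {n : ℕ} {ρ : κ → κ} {s : κ → F} (hρρ : ∀ j, ρ (ρ j) = ρ j)
    (hσ : ∀ b ∈ ratioSubmodule ρ s, ∑ j, b j = 0) {b : κ → F} (hb : b ∈ ratioSubmodule ρ s)
    (p : κ → Fin n → F) : ∑ j, b j • p (ρ j) = 0 := by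
  funext i
  have := hσ (fun j => b j * p (ρ j) i) fun j => by
    change b j * p (ρ j) i = s j * (b (ρ j) * p (ρ (ρ j)) i)
    rw [hρρ, hb j, mul_assoc]
  simpa [Finset.sum_apply] using this

theorem indicator_mem_ratioSubmodule {F κ : Type*} [Field F] [DecidableEq κ] {ρ : κ → κ} {s : κ → F}
    (hρρ : ∀ j, ρ (ρ j) = ρ j) (hs1 : ∀ j, ρ j = j → s j = 1) (r : κ) :
    (fun j => if ρ j = r then s j else 0) ∈ ratioSubmodule ρ s := by
  intro j
  change (if ρ j = r then s j else 0) = s j * (if ρ (ρ j) = r then s (ρ j) else 0)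
  rw [hρρ, hs1 (ρ j) (hρρ j)]
  split_ifs <;> simp

/-- The thresholds for the number of representations. -/
def threshold (q k R i : ℕ) : ℕ := (q ^ k + 1) * (4 * (k + 1) ^ 3 * R) ^ i

/-- The bounds for the number of rare partners. -/
def rareBound (q k R i : ℕ) : ℕ := 4 * (k + 1) ^ 2 * (R * threshold q k R i)

/-- The constant in the condition for the existence of a generic solution. -/
def sizeConstant (q k : ℕ) : ℕ :=
  36 * (k + 1) * (q ^ k + 1) * 2 ^ k * (4 * (k + 1) ^ 3) ^ (k + 1)

theorem threshold_pos (q k : ℕ) {R : ℕ} (hR : 0 < R) (i : ℕ) : 0 < threshold q k R i := by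
  unfold threshold
  positivity

theorem threshold_succ (q k R i : ℕ) :
    threshold q k R (i + 1) = k * rareBound q k R i + 4 * (k + 1) ^ 2 * (R * threshold q k R i) := by
  unfold rareBound threshold
  rw [pow_succ]
  ring

/-- In the modification step `q ^ k` bounds the wrong-ratio equations and `k * rareBound` the values
spoiling other pairs; the recursion is `threshold (i + 1) = (k + 1) * rareBound i`. -/
theorem lt_threshold_succ (q k : ℕ) {R : ℕ} (hR : 0 < R) (i : ℕ) :
    q ^ k + k * rareBound q k R i < threshold q k R (i + 1) := by
  have h1 : q ^ k + 1 ≤ threshold q k R i :=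
    Nat.le_mul_of_pos_right _ (by positivity)
  have h2 : threshold q k R i ≤ 4 * (k + 1) ^ 2 * (R * threshold q k R i) :=
    (Nat.le_mul_of_pos_left _ hR).trans (Nat.le_mul_of_pos_left _ (by positivity))
  rw [threshold_succ]
  omega

theorem threshold_monotone (q k : ℕ) {R : ℕ} (hR : 0 < R) : Monotone (threshold q k R) := by
  refine monotone_nat_of_le_succ fun i => ?_
  exact Nat.mul_le_mul_left _ (Nat.pow_le_pow_right (by positivity) (Nat.le_succ i))

/-- The size needed for popularity on the diagonal; `36 = 4 * 3 * 3`, from the factor `4 * (k + 1)`,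
from `2 * K + 1 ≤ 3 * K` and from the slice rank bound. -/
theorem threshold_mul_le_sizeConstant (q k : ℕ) {R L : ℕ} (hR : 0 < R) :
    36 * (k + 1) * threshold q k R k * L ≤ sizeConstant q k * R ^ (2 * k + 1) * L := by
  refine Nat.mul_le_mul_right _ ?_
  have h1 : (4 * (k + 1) ^ 3) ^ k ≤ 2 ^ k * (4 * (k + 1) ^ 3) ^ (k + 1) :=
    (Nat.pow_le_pow_right (by positivity) (Nat.le_succ k)).trans
      (Nat.le_mul_of_pos_left _ (by positivity))
  have h2 : R ^ k ≤ R ^ (2 * k + 1) := Nat.pow_le_pow_right hR (by omega)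
  calc 36 * (k + 1) * threshold q k R k
      = 36 * (k + 1) * (q ^ k + 1) * ((4 * (k + 1) ^ 3) ^ k * R ^ k) := by
        unfold threshold; rw [mul_pow]; ring
    _ ≤ 36 * (k + 1) * (q ^ k + 1) * ((2 ^ k * (4 * (k + 1) ^ 3) ^ (k + 1)) * R ^ (2 * k + 1)) := by
        gcongr
    _ = _ := by unfold sizeConstant; ring

/-- The size needed for the pigeonhole. The exponent `2 * k + 1` is `k` from the density factor `(2
* R) ^ k` plus `k + 1` from the threshold. -/
theorem pow_mul_threshold_lt_sizeConstant (q k : ℕ) {R L : ℕ} (hR : 0 < R) (hL : 0 < L) :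
    (2 * R) ^ k * threshold q k R (k + 1) < sizeConstant q k * R ^ (2 * k + 1) * L := by
  have h0 : 0 < (2 * R) ^ k * threshold q k R (k + 1) :=
    Nat.mul_pos (by positivity) (threshold_pos q k hR _)
  calc (2 * R) ^ k * threshold q k R (k + 1)
      < 36 * (k + 1) * ((2 * R) ^ k * threshold q k R (k + 1)) := by nlinarith
    _ = sizeConstant q k * R ^ (2 * k + 1) := by
        unfold threshold sizeConstant
        rw [mul_pow, mul_pow (4 * (k + 1) ^ 3) R]
        ring
    _ ≤ _ := Nat.le_mul_of_pos_right _ hL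

end

/-- A tuple of rich points solving the system can be modified to a solution in which the
coefficients of every relation have the right ratio within each column class. -/
theorem exists_solution_of_rich {F V : Type*} [Field F] [Fintype F] [AddCommGroup V] [Module F V]
    [DecidableEq V] {ι : Type*} {k : ℕ} (A : Matrix ι (Fin k) F) (S : Finset V)
    (ρ : Fin k → Fin k) (s : Fin k → F) (hs : ∀ j, s j ≠ 0) (hAs : ∀ i j, A i j = s j * A i (ρ j))
    (hρρ : ∀ j, ρ (ρ j) = ρ j) (hs1 : ∀ j, ρ j = j → s j = 1) {R : ℕ} (hR : 0 < R)
    (x : Fin k → V)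
    (hx : ∀ j, x j ∈ richPoints S s (threshold (Fintype.card F) k R)
      (rareBound (Fintype.card F) k R))
    (hrep : ∀ j, ρ j ≠ j →
      threshold (Fintype.card F) k R k ≤ repCount S (s j) (x (ρ j) + s j • x j))
    (hsol : IsSolution A x) :
    ∃ x' : Fin k → V, (∀ j, x' j ∈ S) ∧ IsSolution A x' ∧
      (∀ b : Fin k → F, Satisfies b x' → b ∈ ratioSubmodule ρ s) ∧
      ∀ b ∈ ratioSubmodule ρ s, ∑ j, b j • x' j = ∑ j, b j • x j := by
  classical
  have hx' := fun j => mem_richPoints.mp (hx j)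
  simp only [Fintype.card_fin, mem_range] at hx'
  let T : Finset (Fin k) := {j | ρ j ≠ j}
  have hT : #T ≤ k := (card_le_univ T).trans_eq (Fintype.card_fin k)
  obtain ⟨y, hyS, hy1, hy2⟩ := exists_generic_modification S ρ s hs
    (threshold (Fintype.card F) k R) (rareBound (Fintype.card F) k R)
    (threshold_monotone _ _ hR)
    (fun i => by simpa using lt_threshold_succ (Fintype.card F) k hR i) T
    (fun j _ => by simp [T, hρρ]) x (fun j => (hx' j).1)
    (fun j _ i hi => (hx' j).2.1 j i (by omega))
    (fun j hj => (threshold_monotone _ _ hR hT).trans (hrep j (mem_filter.mp hj).2))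
  refine ⟨y, hyS, fun i => ?_, fun b hb => ?_, fun b hb => hy1 b fun j _ => hb j⟩
  · exact (hy1 (A i) fun j _ => hAs i j).trans (hsol i)
  · intro j
    by_cases hj : ρ j = j
    · rw [hj, hs1 j hj, one_mul]
    · by_contra hne
      exact hy2 b ⟨j, by simp [T, hj], hne⟩ hb

/-- Finite form of the main result, for a set `S` of density at least `1 / R` whose size exceeds a
power of `R` times the Ellenberg–Gijswijt bound. -/
theorem exists_generic_solution {F : Type*} [Field F] [Fintype F] {m k n : ℕ}
    (A : Matrix (Fin m) (Fin k) F) (hbal : Balanced A) (hA : ∀ j, ∃ i, A i j ≠ 0)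
    (hirr : Irreducible A) (S : Finset (Fin n → F)) {R : ℕ} (hR : 0 < R)
    (hRS : Fintype.card F ^ n ≤ R * #S)
    (hS : sizeConstant (Fintype.card F) k * R ^ (2 * k + 1) * #(lowMonomials (Fintype.card F) n) ≤
      #S) :
    ∃ x : Fin k → (Fin n → F), (∀ j, x j ∈ S) ∧ IsSolution A x ∧
      (∀ b : Fin k → F, BalancedEq b → Satisfies b x → PreservesColClasses A b) ∧
      min ((k : ℤ) - (numColClasses A : ℤ)) ((k : ℤ) - 2) ≤ (affDim (F := F) x : ℤ) := by
  classical
  obtain ⟨ρ, s, hs, hAs, hρρ, hs1, hρ⟩ := exists_column_representatives A hA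
  set q := Fintype.card F with hq
  set L := #(lowMonomials q n) with hL
  have hL0 : 0 < L := one_le_card_lowMonomials Fintype.card_pos n
  have hQ : Fintype.card (Fin n → F) = q ^ n := by rw [Fintype.card_pi_const]
  have hfin : ∀ x : Fin k → (Fin n → F), (∀ b : Fin k → F, Satisfies b x → b ∈ ratioSubmodule ρ s) →
      (numColClasses A ≤ 1 ∨ ∃ b ∈ ratioSubmodule ρ s, b ∉ balancedRelations (F := F) x) →
      min ((k : ℤ) - (numColClasses A : ℤ)) ((k : ℤ) - 2) ≤ (affDim (F := F) x : ℤ) := by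
    intro x hx h
    have h1 := card_le_affDim_add_finrank (F := F) x
    rw [Fintype.card_fin] at h1
    have h2 := finrank_ratioSubmodule_le A ρ s hρ
    have hle : balancedRelations (F := F) x ≤ ratioSubmodule ρ s := fun b hb => hx b hb.2
    have h3 := Submodule.finrank_mono hle
    -- With at most one class, `k - 1 - ℓ ≥ k - 2`; otherwise the strict inclusion of the relations
    -- gains the missing `1`.
    rcases h with h | ⟨b, hb, hb'⟩
    · omega
    · have h4 := Submodule.finrank_lt_finrank_of_lt (lt_of_le_of_ne hle fun h => hb' (h ▸ hb))
      omega
  set K := threshold q k R with hK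
  set M := rareBound q k R with hM
  have hKS : 36 * (k + 1) * K k * L ≤ #S := (threshold_mul_le_sizeConstant q k hR).trans hS
  have hrich : #S ≤ 2 * #(richPoints S s K M) := by
    refine card_le_two_mul_card_richPoints S s K M R (hQ ▸ hRS) hR (threshold_pos q k hR)
      (fun i => by simp [hM, hK, rareBound]) fun j => ?_
    rw [Fintype.card_fin]
    set Z : Finset (Fin n → F) := {a ∈ S | repCount S (s j) (a + s j • a) < K k} with hZ
    have h1 : #Z ≤ (2 * K k + 1) * (3 * L) := by
      refine card_le_of_repCount_le Z (s j) (K k) fun a ha => ?_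
      exact (repCount_mono (filter_subset _ _) _ _).trans (mem_filter.mp ha).2.le
    have hK1 : 1 ≤ K k := threshold_pos q k hR k
    calc 4 * (k + 1) * #Z ≤ 4 * (k + 1) * ((3 * K k) * (3 * L)) := by
          refine Nat.mul_le_mul_left _ (h1.trans (Nat.mul_le_mul_right _ (by omega)))
      _ = 36 * (k + 1) * K k * L := by ring
      _ ≤ #S := hKS
  have hS0 : 0 < #S := by
    have : 0 < 36 * (k + 1) * K k * L := by
      have := threshold_pos q k hR k
      exact Nat.mul_pos (Nat.mul_pos (by omega) this) hL0
    omega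
  -- In the first case a constant tuple suffices: it solves the balanced system, and either there is
  -- at most one class or an unbalanced vector of the submodule is excluded from the balanced
  -- relations.
  by_cases hcase : (∀ j j', ρ j = ρ j') ∨ ∃ b ∈ ratioSubmodule ρ s, ∑ j, b j ≠ 0
  · obtain ⟨a, ha⟩ : (richPoints S s K M).Nonempty := card_pos.mp (by omega)
    obtain ⟨x, hxS, hxA, hx, -⟩ := exists_solution_of_rich A S ρ s hs hAs hρρ hs1 hR (fun _ => a)
      (fun _ => ha) (fun j _ => by
        have := (mem_richPoints.mp ha).2.2 j
        rwa [Fintype.card_fin] at this)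
      (fun i => by
        rw [Satisfies, ← Finset.sum_smul, hbal i, zero_smul])
    refine ⟨x, hxS, hxA, fun b _ hb =>
      preservesColClasses_of_ratio A ρ s hs hAs hρ b (hx b hb), hfin x hx ?_⟩
    rcases hcase with h | ⟨b, hb, hb0⟩
    · exact Or.inl (numColClasses_le_one fun j j' => (hρ j j').mpr (h j j'))
    · exact Or.inr ⟨b, hb, fun h => hb0 h.1⟩
  · push Not at hcase
    obtain ⟨⟨j₁, j₂, hne⟩, hσ⟩ := hcase
    obtain ⟨t, r₀, hr₀, ht1, ht0, htA⟩ := hirr.exists_dependence ρ s hAs hρρ j₁ j₂ hne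
    obtain ⟨k', rfl⟩ : ∃ k', k = k' + 1 := ⟨k - 1, by have := j₁.pos; omega⟩
    -- The rich points have density at least `1 / (2 * R)`, so the average fibre has at least `N /
    -- (2 * R) ^ k'` tuples, more than `K (k' + 2)`.
    obtain ⟨p, p', y, hp, hp', hy, hpp', hrep⟩ := exists_rich_pair S ρ s K M t r₀ ht1 (by
      rw [hQ, Fintype.card_fin, Nat.add_sub_cancel, pow_succ]
      set N := #(richPoints S s K M) with hN
      have h1 : 1 + (k' + 1) * M (k' + 1) ≤ K (k' + 1 + 1) := by
        have := lt_threshold_succ q (k' + 1) hR (k' + 1)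
        change q ^ (k' + 1) + (k' + 1) * M (k' + 1) < K (k' + 1 + 1) at this
        omega
      have h2 : q ^ n ≤ 2 * R * N := by
        calc q ^ n ≤ R * #S := hRS
          _ ≤ R * (2 * N) := Nat.mul_le_mul_left _ hrich
          _ = _ := by ring
      have h3 : (2 * R) ^ (k' + 1) * K (k' + 1 + 1) < 2 * N :=
        ((pow_mul_threshold_lt_sizeConstant q (k' + 1) hR hL0).trans_le hS).trans_le hrich
      have h4 : (2 * R) ^ k' * K (k' + 1 + 1) < N := by
        refine Nat.lt_of_mul_lt_mul_left (a := 2) (lt_of_le_of_lt ?_ h3)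
        rw [pow_succ]
        have : 2 ≤ 2 * R := by omega
        calc 2 * ((2 * R) ^ k' * K (k' + 1 + 1)) = (2 * R) ^ k' * 2 * K (k' + 1 + 1) := by ring
          _ ≤ _ := by gcongr
      have hN0 : 0 < N := by omega
      calc (q ^ n) ^ k' * (1 + (k' + 1) * M (k' + 1))
          ≤ (2 * R * N) ^ k' * K (k' + 1 + 1) := by gcongr
        _ = N ^ k' * ((2 * R) ^ k' * K (k' + 1 + 1)) := by rw [mul_pow]; ring
        _ < N ^ k' * N := Nat.mul_lt_mul_of_pos_left h4 (pow_pos hN0 k'))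
    rw [Fintype.card_fin] at hrep
    -- The part `p' (ρ j)` contributes nothing to equations in the submodule, so such a `b` takes
    -- the value `(∑ j, t j * b j) • y`: zero for the rows of `A`, by the dependence `t`.
    let x₀ : Fin (k' + 1) → (Fin n → F) := fun j => p' (ρ j) + t j • y
    have hx₀ : ∀ j, ρ j = j → x₀ j = p j := fun j hj => by
      simp only [x₀]; rw [hj, hpp']
    have hx₀' : ∀ j, ρ j ≠ j → x₀ j = p' (ρ j) := fun j hj => by
      simp [x₀, ht0 j hj]
    have hsum : ∀ b ∈ ratioSubmodule ρ s, ∑ j, b j • x₀ j = (∑ j, t j * b j) • y := by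
      intro b hb
      simp only [x₀, smul_add, Finset.sum_add_distrib]
      rw [sum_smul_comp_eq_zero hρρ hσ hb, zero_add, Finset.sum_smul]
      refine Finset.sum_congr rfl fun j _ => ?_
      rw [smul_smul, mul_comm]
    obtain ⟨x, hxS, hxA, hx, hxsum⟩ := exists_solution_of_rich A S ρ s hs hAs hρρ hs1 hR x₀
      (fun j => by
        by_cases hj : ρ j = j
        · rw [hx₀ j hj]; exact hp j
        · rw [hx₀' j hj]; exact hp' _)
      (fun j hj => by
        rw [hx₀' j hj, hx₀ (ρ j) (hρρ j)]
        exact hrep j)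
      (fun i => by
        rw [Satisfies, hsum (A i) (hAs i), htA, zero_smul])
    refine ⟨x, hxS, hxA, fun b _ hb =>
      preservesColClasses_of_ratio A ρ s hs hAs hρ b (hx b hb), hfin x hx (Or.inr ?_)⟩
    -- The equation supported on the class of `r₀` takes the value `t r₀ • y = y ≠ 0`.
    have hmem := indicator_mem_ratioSubmodule (s := s) hρρ hs1 r₀
    refine ⟨_, hmem, fun h => hy ?_⟩
    have h1 := h.2
    rw [Satisfies, hxsum _ hmem, hsum _ hmem, Finset.sum_eq_single r₀] at h1
    · simpa [hr₀, ht1, hs1 r₀ hr₀] using h1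
    · intro j _ hj
      by_cases hjj : ρ j = j
      · rw [hjj, if_neg hj, mul_zero]
      · rw [ht0 j hjj, zero_mul]
    · simp

end LinSys

/-! ### Choice of the constants -/

theorem theoremC {F : Type*} [Field F] [Fintype F] {m k : ℕ} (A : Matrix (Fin m) (Fin k) F)
    (hRC : LinSys.TypeRC A) (hnd : LinSys.NonDegenerate A) (hirr : LinSys.Irreducible A) :
    ∃ β γ : ℝ, 0 < β ∧ 0 < γ ∧ γ < (Fintype.card F : ℝ) ∧
      ∀ (n : ℕ) (S : Finset (Fin n → F)), β * γ ^ n ≤ (S.card : ℝ) →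
        ∃ x : Fin k → (Fin n → F), (∀ j, x j ∈ S) ∧ LinSys.IsSolution A x ∧
          (∀ b : Fin k → F, LinSys.BalancedEq b → LinSys.Satisfies b x →
            LinSys.PreservesColClasses A b) ∧
          min ((k : ℤ) - (LinSys.numColClasses A : ℤ)) ((k : ℤ) - 2) ≤
            (LinSys.affDim (F := F) x : ℤ) := by
  set q := Fintype.card F with hq
  have hq1 : 1 < q := Fintype.one_lt_card
  obtain ⟨g, hg1, hgq, hg⟩ := LinSys.exists_card_lowMonomials_le hq1
  have hg0 : 0 < g := one_pos.trans_le hg1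
  have hq0 : (0 : ℝ) < q := by exact_mod_cast zero_lt_one.trans hq1
  -- With `R = ⌈q ^ n / |S|⌉ ≤ 2 * q ^ n / |S|`, the size condition follows from `C * (q ^ d * g) ^
  -- n ≤ |S| ^ (d + 1)`, the factor `2` giving `2 ^ d` in `C`. Hence `γ` is the `(d + 1)`-th root of
  -- `q ^ d * g`, below `q` because `g < q`.
  set d := 2 * k + 1 with hd
  set γ : ℝ := ((q : ℝ) ^ d * g) ^ ((1 : ℝ) / (d + 1 : ℕ)) with hγ
  have hγ0 : 0 < γ := by positivity
  have hγd : γ ^ (d + 1) = (q : ℝ) ^ d * g := by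
    rw [hγ, one_div]
    exact Real.rpow_inv_natCast_pow (by positivity) (by omega)
  set C : ℝ := (LinSys.sizeConstant q k : ℝ) * 2 ^ d with hC
  have hC1 : 1 ≤ C := by
    have h1 : 1 ≤ LinSys.sizeConstant q k := by
      unfold LinSys.sizeConstant
      exact Nat.one_le_iff_ne_zero.mpr (by positivity)
    have h1' : (1 : ℝ) ≤ LinSys.sizeConstant q k := by exact_mod_cast h1
    exact one_le_mul_of_one_le_of_one_le h1' (one_le_pow₀ one_le_two)
  have hC0 : 0 < C := one_pos.trans_le hC1
  refine ⟨C, γ, hC0, hγ0, ?_, fun n S hS => ?_⟩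
  · refine lt_of_pow_lt_pow_left₀ (d + 1) hq0.le ?_
    rw [hγd, pow_succ]
    exact mul_lt_mul_of_pos_left hgq (by positivity)
  have hN0 : (0 : ℝ) < S.card := lt_of_lt_of_le (by positivity) hS
  have hNQ : (S.card : ℝ) ≤ (q : ℝ) ^ n := by
    have := Finset.card_le_univ S
    rw [Fintype.card_pi_const, ← hq] at this
    exact_mod_cast this
  set R := ⌈(q : ℝ) ^ n / S.card⌉₊ with hR
  have hQN1 : 1 ≤ (q : ℝ) ^ n / S.card := (one_le_div hN0).mpr hNQ
  have hR0 : 0 < R := Nat.ceil_pos.mpr (one_pos.trans_le hQN1)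
  have hR2 : (R : ℝ) ≤ 2 * ((q : ℝ) ^ n / S.card) := by
    have := Nat.ceil_lt_add_one (zero_le_one.trans hQN1)
    linarith
  refine LinSys.exists_generic_solution A hRC.1 hnd.2 hirr S hR0 ?_ ?_
  · have := (div_le_iff₀ hN0).mp (Nat.le_ceil ((q : ℝ) ^ n / S.card))
    rw [← hR] at this
    clear_value R
    exact_mod_cast this
  · rw [← hq, ← hd]
    suffices h : (LinSys.sizeConstant q k : ℝ) * (R : ℝ) ^ d * ((LinSys.lowMonomials q n).card : ℝ) ≤
        S.card by exact_mod_cast h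
    have h1 : C * ((q : ℝ) ^ d * g) ^ n ≤ (S.card : ℝ) ^ (d + 1) := by
      calc C * ((q : ℝ) ^ d * g) ^ n = C * (γ ^ n) ^ (d + 1) := by
            rw [← hγd, ← pow_mul, ← pow_mul, mul_comm n]
        _ ≤ C ^ (d + 1) * (γ ^ n) ^ (d + 1) := by
            gcongr
            exact le_self_pow₀ hC1 (by omega)
        _ = (C * γ ^ n) ^ (d + 1) := (mul_pow _ _ _).symm
        _ ≤ _ := by gcongr
    calc (LinSys.sizeConstant q k : ℝ) * (R : ℝ) ^ d * ((LinSys.lowMonomials q n).card : ℝ)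
        ≤ (LinSys.sizeConstant q k : ℝ) * (2 * ((q : ℝ) ^ n / S.card)) ^ d * g ^ n := by
          gcongr
          exact hg n
      _ = C * ((q : ℝ) ^ d * g) ^ n / (S.card : ℝ) ^ d := by
          rw [hC, mul_pow 2, div_pow, mul_pow _ g, ← pow_mul, ← pow_mul, mul_comm n d]
          ring
      _ ≤ S.card := by
          rw [div_le_iff₀ (by positivity)]
          exact h1.trans_eq (pow_succ' _ _)
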